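/- **Conventions.** Metric graphs are connected, with all edges of length $1$. For a metric space $X$, $A\subset X$ and $r\ge 0$, $N_r(A)$ is the set of points at distance $\le r$ from some point of $A$. A geodesic metric space is $\delta$-hyperbolic if in every geodesic triangle each side lies in the $N_\delta$-neighbourhood of the union of the other two. A set $A\subset X$ is $K$-quasiconvex if every geodesic with end points in $A$ lies in $N_K(A)$. Paths are maps $c:[0,N]\cap\mathbb Z\to X$ ($N \geq 0$ an integer), concatenated in the usual way; $c$ is a $k$-quasigeodesic if $|s-t|/k-k\le d(c(s),c(t))\le k|s-t|+k$ for all $s,t$. A point $y\in A$ is an $\epsilon$-approximate nearest point projection of $x$ on $A$ if $d(x,y)\le d(x,z)+\epsilon$ for all $z\in A$. Sets $A,B$ are $D$-cobounded if for every $1$-approximate nearest point projection map $X\to B$ (one that is the identity on $B$) the image of $A$ has diameter $\le D$, and vice versa. For a function $R:\mathbb R\to\mathbb R$, a set $Z$ coarsely bisects $Y$ into $Y^-,Y^+$ with control function $R$ if $Y=Y^-\cup Y^+$, $Y^\pm\setminus Z\ne\emptyset$ and for all $k\ge1$ every $k$-quasigeodesic of $X$ joining a point of $Y^-$ to a point of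 $Y^+$ meets $N_{R(k)}(Z)$. **Setting.** Let $X$ be a $\delta$-hyperbolic metric graph, $I\subset\mathbb R$ an interval with end points in $\mathbb Z\cup\{\pm\infty\}$, $Y\subset X$ a $K$-quasiconvex subset, and $\Pi:Y\to I$ a map whose image contains $I\cap\mathbb Z$ (for instance, a surjective map). Put $Y_i=\Pi^{-1}(i)$ for $i\in I\cap\mathbb Z$ and $Y_{ij}=\Pi^{-1}([i,j])$ for $i<j$ in $I\cap\mathbb Z$. Assume: 1. all $Y_i$ and $Y_{ij}$ are $K$-quasiconvex in $X$; 2. for every integer $i$ in the interior of $I$, $Y_i$ coarsely bisects $Y$ into $\Pi^{-1}((-\infty,i]\cap I)$ and $\Pi^{-1}([i,\infty)\cap I)$ with control function $R$ ($R$ independent of $i$); 3. $d(Y_{i\,i+1},Y_{j\,j+1})>2K+1$ for all integers $i,j\in I$ with $j+1\in I$ and $i+1<j$. **Proposition.** Let $\delta,K,D\ge0$, $\epsilon\ge1$ and a function $R:\mathbb R\to\mathbb R$ be given. There is $\mu\ge0$ depending only on $\delta,K,R,D,\epsilon$ and, for every $\lambda\ge1$, a $\lambda'\ge1$ depending only on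 $\delta,K,R,D,\epsilon,\lambda$, such that the following holds for all $X,Y,I,\Pi$ as in the setting. Let $m<n$ be integers in $I$ and suppose that $Y_i$ and $Y_j$ are $D$-cobounded in $X$ whenever $m+1\le i<j\le n-1$. Let $y\in Y_m$, and let $y_m=y$ and $y_{i+1}$ be an $\epsilon$-approximate nearest point projection of $y_i$ on $Y_{i+1}$ for $m\le i\le n-1$. Then: (a) If $y'\in Y_n$, if $\alpha_i$ is a $\lambda$-quasigeodesic of $X$ contained in $Y_{i\,i+1}$ and joining $y_i$ to $y_{i+1}$ for $m\le i\le n-1$, and if $\beta$ is a $\lambda$-quasigeodesic of $X$ joining $y_n$ to $y'$, then the concatenation $\alpha_m*\alpha_{m+1}*\cdots*\alpha_{n-1}*\beta$ is a $\lambda'$-quasigeodesic of $X$ joining $y$ to $y'$. (b) For $m+2\le i\le n$ the point $y_i$ is a $\mu$-approximate nearest point projection of $y$ on $Y_i$. -/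

import Mathlib

/-! ### Metric graphs and geodesics -/

/-- `PLChain E x y L`: there is a piecewise linear path of length `L` from `x` to `y`, each piece of
which is the image of an affine path (from parameter `s` to parameter `t`) in one of the edges
`e : [0,1] → X` of the family `E`. -/
inductive PLChain {X : Type*} (E : Set (unitInterval → X)) : X → X → ℝ → Prop
  | nil (x : X) : PLChain E x x 0
  | snoc {x : X} {L : ℝ} (e : unitInterval → X) (he : e ∈ E) (s t : unitInterval)
      (h : PLChain E x (e s) L) : PLChain E x (e t) (L + |(s : ℝ) - (t : ℝ)|)

/-- `X` is the (connected) metric graph with vertex set `V` and edges `E`, all of length `1`: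
it is the disjoint union of `V` and of the open edges, and the distance is the infimum of the
lengths of piecewise linear paths (in particular such paths exist). Loops and multiple edges are
allowed. -/
structure IsMetricGraphOn (X : Type*) [MetricSpace X] (V : Set X) (E : Set (unitInterval → X)) :
    Prop where
  ends : ∀ e ∈ E, e 0 ∈ V ∧ e 1 ∈ V
  interior_not_vertex : ∀ e ∈ E, ∀ t : unitInterval, 0 < t → t < 1 → e t ∉ V
  interior_injective : ∀ e ∈ E, ∀ e' ∈ E, ∀ s t : unitInterval, 0 < s → s < 1 → 0 < t → t < 1 →
    e s = e' t → e = e' ∧ s = t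
  cover : ∀ x : X, x ∈ V ∨ ∃ e ∈ E, ∃ t, e t = x
  dist_isGLB : ∀ x y : X, IsGLB {L : ℝ | PLChain E x y L} (dist x y)

/-- `X` is a connected metric graph all of whose edges have length `1`. -/
def IsMetricGraph (X : Type*) [MetricSpace X] : Prop :=
  ∃ (V : Set X) (E : Set (unitInterval → X)), IsMetricGraphOn X V E

/-- The closed `r`-neighbourhood `N_r(A)`. -/
def nbhd {X : Type*} [MetricSpace X] (r : ℝ) (A : Set X) : Set X :=
  {x | ∃ a ∈ A, dist x a ≤ r}

/-- The distance `d(A,B)` of two (nonempty) sets. -/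
noncomputable def setDist {X : Type*} [MetricSpace X] (A B : Set X) : ℝ :=
  sInf (Set.image2 dist A B)

/-- `S` is (the image of) a geodesic joining `x` and `y`. -/
def IsGeodesicSegment {X : Type*} [MetricSpace X] (S : Set X) (x y : X) : Prop :=
  ∃ (l : ℝ) (c : ℝ → X), 0 ≤ l ∧ c 0 = x ∧ c l = y ∧
    (∀ s ∈ Set.Icc 0 l, ∀ t ∈ Set.Icc 0 l, dist (c s) (c t) = |s - t|) ∧
    S = c '' Set.Icc 0 l

/-- `X` is a geodesic metric space which is `δ`-hyperbolic in the sense of Rips: all geodesic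
triangles are `δ`-slim. -/
def IsRipsHyperbolic (X : Type*) [MetricSpace X] (δ : ℝ) : Prop :=
  (∀ x y : X, ∃ S : Set X, IsGeodesicSegment S x y) ∧
  ∀ (x₁ x₂ x₃ : X) (S₁₂ S₂₃ S₁₃ : Set X),
    IsGeodesicSegment S₁₂ x₁ x₂ → IsGeodesicSegment S₂₃ x₂ x₃ → IsGeodesicSegment S₁₃ x₁ x₃ →
    S₁₂ ⊆ nbhd δ (S₂₃ ∪ S₁₃) ∧ S₂₃ ⊆ nbhd δ (S₁₂ ∪ S₁₃) ∧ S₁₃ ⊆ nbhd δ (S₁₂ ∪ S₂₃)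

/-- `A` is `K`-quasiconvex: every geodesic with end points in `A` lies in `N_K(A)`. -/
def IsQuasiconvex {X : Type*} [MetricSpace X] (K : ℝ) (A : Set X) : Prop :=
  ∀ a ∈ A, ∀ b ∈ A, ∀ S : Set X, IsGeodesicSegment S a b → S ⊆ nbhd K A

/-! ### Dotted paths and quasigeodesics -/

/-- A dotted path `[0, len] ∩ ℤ → X`; the values of `toFun` beyond `len` play no role. -/
structure DottedPath (X : Type*) where
  len : ℕ
  toFun : ℕ → X

namespace DottedPath

variable {X : Type*}

/-- The path joins `x` to `y`. -/
def Joins (c : DottedPath X) (x y : X) : Prop := c.toFun 0 = x ∧ c.toFun c.len = y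

/-- The set of points on the path. -/
def range (c : DottedPath X) : Set X := {x | ∃ t ≤ c.len, c.toFun t = x}

/-- The path of length `0` at `x`. -/
def const (x : X) : DottedPath X := ⟨0, fun _ => x⟩

/-- The concatenation `c * c'` (meant for the case that `c` ends where `c'` starts). -/
def concat (c c' : DottedPath X) : DottedPath X :=
  ⟨c.len + c'.len, fun t => if t ≤ c.len then c.toFun t else c'.toFun (t - c.len)⟩

/-- The concatenation `α m * α (m+1) * ⋯ * α (m+k-1)` of `k` paths. -/
def concatFrom (α : ℤ → DottedPath X) (m : ℤ) : ℕ → DottedPath X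
  | 0 => const ((α m).toFun 0)
  | k + 1 => (concatFrom α m k).concat (α (m + k))

/-- A `k`-quasigeodesic, that is, a `(k,k)`-quasi-isometric embedding `[0, len] ∩ ℤ → X`. -/
def IsQuasigeodesic [MetricSpace X] (k : ℝ) (c : DottedPath X) : Prop :=
  ∀ s ≤ c.len, ∀ t ≤ c.len,
    |(s : ℝ) - t| / k - k ≤ dist (c.toFun s) (c.toFun t) ∧
    dist (c.toFun s) (c.toFun t) ≤ k * |(s : ℝ) - t| + k

end DottedPath

/-! ### Coarse bisection, approximate projections, coboundedness -/

/-- `Z` coarsely bisects `Y` into `Y₁` and `Y₂`, with control function `R`: every `k`-quasigeodesic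
joining a point of `Y₁` to a point of `Y₂` meets `N_{R(k)}(Z)`. A family of such configurations
is uniform if the same `R` serves for all of its members. -/
def CoarselyBisects {X : Type*} [MetricSpace X] (R : ℝ → ℝ) (Z Y Y₁ Y₂ : Set X) : Prop :=
  Y = Y₁ ∪ Y₂ ∧ (Y₁ \ Z).Nonempty ∧ (Y₂ \ Z).Nonempty ∧
  ∀ k : ℝ, 1 ≤ k → ∀ y₁ ∈ Y₁, ∀ y₂ ∈ Y₂, ∀ c : DottedPath X,
    c.IsQuasigeodesic k → c.Joins y₁ y₂ → (c.range ∩ nbhd (R k) Z).Nonempty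

/-- `y` is an `ε`-approximate nearest point projection of `x` on `A`. -/
def IsApproxProj {X : Type*} [MetricSpace X] (ε : ℝ) (A : Set X) (x y : X) : Prop :=
  y ∈ A ∧ ∀ z ∈ A, dist x y ≤ dist x z + ε

/-- `f` is an `ε`-approximate nearest point projection map onto `A`. -/
def IsApproxProjMap {X : Type*} [MetricSpace X] (ε : ℝ) (A : Set X) (f : X → X) : Prop :=
  (∀ a ∈ A, f a = a) ∧ ∀ x, IsApproxProj ε A x (f x)

/-- `A` and `B` are `D`-cobounded: the image of each of them under any `1`-approximate nearest point
projection map onto the other has diameter at most `D`. -/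
def Cobounded {X : Type*} [MetricSpace X] (D : ℝ) (A B : Set X) : Prop :=
  (∀ f : X → X, IsApproxProjMap 1 B f → ∀ a ∈ A, ∀ a' ∈ A, dist (f a) (f a') ≤ D) ∧
  (∀ f : X → X, IsApproxProjMap 1 A f → ∀ b ∈ B, ∀ b' ∈ B, dist (f b) (f b') ≤ D)

/-! ### The decomposition of `Y` into slabs -/

/-- `I` is an interval of `ℝ` with end points in `ℤ ∪ {∞, -∞}`. -/
def IsIntegralInterval (I : Set ℝ) : Prop :=
  I.Nonempty ∧ I.OrdConnected ∧
  (∀ a, IsGLB I a → ∃ n : ℤ, (n : ℝ) = a) ∧ (∀ b, IsLUB I b → ∃ n : ℤ, (n : ℝ) = b)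

/-- The fibre `Y_i`. -/
def fibre {X : Type*} (Y : Set X) (p : X → ℝ) (i : ℤ) : Set X := {x ∈ Y | p x = i}

/-- The slab `Y_{ij}`. -/
def slab {X : Type*} (Y : Set X) (p : X → ℝ) (i j : ℤ) : Set X :=
  {x ∈ Y | (i : ℝ) ≤ p x ∧ p x ≤ j}

/-- The standing assumptions on `Y` and on the map `p : Y → I` (whose values outside `Y` play no
role), with quasiconvexity constant `K` and bisection function `R`. -/
structure IsSlabDecomposition {X : Type*} [MetricSpace X] (K : ℝ) (R : ℝ → ℝ)
    (Y : Set X) (I : Set ℝ) (p : X → ℝ) : Prop where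
  interval : IsIntegralInterval I
  quasiconvex : IsQuasiconvex K Y
  mapsTo : Set.MapsTo p Y I
  surj : ∀ i : ℤ, (i : ℝ) ∈ I → (fibre Y p i).Nonempty
  fibre_quasiconvex : ∀ i : ℤ, (i : ℝ) ∈ I → IsQuasiconvex K (fibre Y p i)
  slab_quasiconvex : ∀ i j : ℤ, (i : ℝ) ∈ I → (j : ℝ) ∈ I → i < j →
    IsQuasiconvex K (slab Y p i j)
  bisects : ∀ i : ℤ, (i : ℝ) ∈ interior I →
    CoarselyBisects R (fibre Y p i) Y {x ∈ Y | p x ≤ i} {x ∈ Y | (i : ℝ) ≤ p x}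
  far : ∀ i j : ℤ, (i : ℝ) ∈ I → (j : ℝ) ∈ I → ((j + 1 : ℤ) : ℝ) ∈ I → i + 1 < j →
    2 * K + 1 < setDist (slab Y p i (i + 1)) (slab Y p j (j + 1))

/-! ### Geodesic segments -/

namespace IsGeodesicSegment

variable {X : Type*} [MetricSpace X] {S : Set X} {x y : X}

theorem symm (h : IsGeodesicSegment S x y) : IsGeodesicSegment S y x := by
  obtain ⟨l, c, hl, h0, h1, hd, rfl⟩ := h
  refine ⟨l, fun t => c (l - t), hl, by simpa using h1, by simpa using h0, ?_, ?_⟩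
  · intro s hs t ht
    rw [hd _ ⟨by linarith [hs.2], by linarith [hs.1]⟩ _ ⟨by linarith [ht.2], by linarith [ht.1]⟩,
      abs_sub_comm]
    congr 1
    ring
  · ext q
    constructor
    · rintro ⟨t, ht, rfl⟩
      exact ⟨l - t, ⟨by linarith [ht.2], by linarith [ht.1]⟩, by simp⟩
    · rintro ⟨t, ht, rfl⟩
      exact ⟨l - t, ⟨by linarith [ht.2], by linarith [ht.1]⟩, rfl⟩

theorem dist_add_dist (h : IsGeodesicSegment S x y) {q : X} (hq : q ∈ S) :
    dist x q + dist q y = dist x y := by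
  obtain ⟨l, c, hl, rfl, rfl, hd, rfl⟩ := h
  obtain ⟨t, ht, rfl⟩ := hq
  rw [hd _ ⟨le_rfl, hl⟩ _ ht, hd _ ht _ ⟨hl, le_rfl⟩, hd _ ⟨le_rfl, hl⟩ _ ⟨hl, le_rfl⟩,
    abs_of_nonpos (by linarith [ht.1]), abs_of_nonpos (by linarith [ht.2]),
    abs_of_nonpos (by linarith)]
  ring

theorem exists_dist_eq (h : IsGeodesicSegment S x y) {ρ : ℝ} (h0 : 0 ≤ ρ) (h1 : ρ ≤ dist x y) :
    ∃ w ∈ S, dist x w = ρ := by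
  obtain ⟨l, c, hl, rfl, rfl, hd, rfl⟩ := h
  rw [hd _ ⟨le_rfl, hl⟩ _ ⟨hl, le_rfl⟩, abs_of_nonpos (by linarith)] at h1
  refine ⟨c ρ, ⟨ρ, ⟨h0, by linarith⟩, rfl⟩, ?_⟩
  rw [hd _ ⟨le_rfl, hl⟩ _ ⟨h0, by linarith⟩, abs_of_nonpos (by linarith)]
  ring

end IsGeodesicSegment

theorem isGeodesicSegment_image_Icc {X : Type*} [MetricSpace X] {l : ℝ} {c : ℝ → X}
    (hd : ∀ s ∈ Set.Icc 0 l, ∀ t ∈ Set.Icc 0 l, dist (c s) (c t) = |s - t|)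
    {a b : ℝ} (ha : 0 ≤ a) (hab : a ≤ b) (hb : b ≤ l) :
    IsGeodesicSegment (c '' Set.Icc a b) (c a) (c b) := by
  refine ⟨b - a, fun t => c (a + t), by linarith, by simp, by simp, ?_, ?_⟩
  · intro s hs t ht
    rw [hd _ ⟨by linarith [hs.1], by linarith [hs.2]⟩ _ ⟨by linarith [ht.1], by linarith [ht.2]⟩]
    congr 1
    ring
  · ext q
    constructor
    · rintro ⟨t, ht, rfl⟩
      exact ⟨t - a, ⟨by linarith [ht.1], by linarith [ht.2]⟩, by simp⟩
    · rintro ⟨t, ht, rfl⟩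
      exact ⟨a + t, ⟨by linarith [ht.1], by linarith [ht.2]⟩, rfl⟩

/-! ### Stability of quasigeodesics -/

theorem IsRipsHyperbolic.exists_near_chain {X : Type*} [MetricSpace X] {δ : ℝ}
    (hX : IsRipsHyperbolic X δ) (n : ℕ) :
    ∀ (f : ℕ → X) (S : Set X), IsGeodesicSegment S (f 0) (f (2 ^ n)) → ∀ p ∈ S,
      ∃ i < 2 ^ n, ∃ T, IsGeodesicSegment T (f i) (f (i + 1)) ∧ ∃ q ∈ T, dist p q ≤ δ * n := by
  induction n with
  | zero =>
    intro f S hS p hp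
    exact ⟨0, by simp, S, by simpa using hS, p, hp, by simp⟩
  | succ n ih =>
    intro f S hS p hp
    obtain ⟨S₁, h₁⟩ := hX.1 (f 0) (f (2 ^ n))
    obtain ⟨S₂, h₂⟩ := hX.1 (f (2 ^ n)) (f (2 ^ (n + 1)))
    obtain ⟨q, hq, hpq⟩ := (hX.2 _ _ _ _ _ _ h₁ h₂ hS).2.2 hp
    have e : 2 ^ (n + 1) = 2 ^ n + 2 ^ n := by ring
    rcases hq with hq | hq
    · obtain ⟨i, hi, T, hT, w, hw, hqw⟩ := ih f S₁ h₁ q hq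
      refine ⟨i, by omega, T, hT, w, hw, ?_⟩
      push_cast
      linarith [dist_triangle p q w]
    · obtain ⟨i, hi, T, hT, w, hw, hqw⟩ := ih (fun i => f (2 ^ n + i)) S₂
        (by simpa [e] using h₂) q hq
      refine ⟨2 ^ n + i, by omega, T, hT, w, hw, ?_⟩
      push_cast
      linarith [dist_triangle p q w]

theorem exists_linear_le_two_pow (A B : ℝ) : ∃ n₀ : ℕ, ∀ n ≥ n₀, A * n + B ≤ (2 : ℝ) ^ n := by
  have h1 := tendsto_pow_const_div_const_pow_of_one_lt 1 (r := (2 : ℝ)) (by norm_num)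
  have h2 := tendsto_pow_const_div_const_pow_of_one_lt 0 (r := (2 : ℝ)) (by norm_num)
  have h3 := (h1.const_mul A).add (h2.const_mul B)
  simp only [mul_zero, add_zero] at h3
  obtain ⟨n₀, h⟩ := Filter.eventually_atTop.1 (h3.eventually_le_const (u := 1) (by norm_num))
  refine ⟨n₀, fun n hn => ?_⟩
  have := h n hn
  have hp : (0 : ℝ) < 2 ^ n := by positivity
  rw [← mul_div_assoc, ← mul_div_assoc, ← add_div, div_le_one hp] at this
  simpa using this

namespace DottedPath

variable {X : Type*} [MetricSpace X] {lam : ℝ} {c : DottedPath X}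

theorem IsQuasigeodesic.dist_succ_le (hc : c.IsQuasigeodesic lam) {t : ℕ} (ht : t + 1 ≤ c.len) :
    dist (c.toFun t) (c.toFun (t + 1)) ≤ 2 * lam := by
  have := (hc t (by omega) (t + 1) ht).2
  push_cast at this
  rw [show (t : ℝ) - (t + 1) = -1 by ring] at this
  norm_num at this
  linarith

theorem IsQuasigeodesic.sub_le (hc : c.IsQuasigeodesic lam) (hlam : 1 ≤ lam) {s t : ℕ}
    (hst : s ≤ t) (ht : t ≤ c.len) :
    (t : ℝ) - s ≤ lam * (dist (c.toFun s) (c.toFun t) + lam) := by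
  have h := (hc s (hst.trans ht) t ht).1
  have hst' : (s : ℝ) ≤ t := by exact_mod_cast hst
  rw [abs_of_nonpos (by linarith), sub_le_iff_le_add, div_le_iff₀ (by linarith)] at h
  linarith

theorem IsQuasigeodesic.dist_le (hc : c.IsQuasigeodesic lam) {s t : ℕ}
    (hst : s ≤ t) (ht : t ≤ c.len) :
    dist (c.toFun s) (c.toFun t) ≤ lam * ((t : ℝ) - s) + lam := by
  have h := (hc s (hst.trans ht) t ht).2
  have hst' : (s : ℝ) ≤ t := by exact_mod_cast hst
  rwa [abs_of_nonpos (by linarith), neg_sub] at h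

theorem IsQuasigeodesic.exists_dist_le_of_chain {δ : ℝ} (hX : IsRipsHyperbolic X δ) (hδ : 0 ≤ δ)
    (hlam : 1 ≤ lam) (hc : c.IsQuasigeodesic lam) {D : ℝ} {n : ℕ}
    (hn : lam * (6 * D + lam) + 2 ≤ (2 : ℝ) ^ n) (hD : δ * n < D)
    {x y p : X} {S : Set X} (hS : IsGeodesicSegment S x y) (hp : p ∈ S) {a b : ℕ} (hab : a ≤ b)
    (hb : b ≤ c.len) (hxa : dist x (c.toFun a) ≤ D) (hyb : dist y (c.toFun b) ≤ D)
    (hx : 2 * D ≤ dist p x ∨ x = c.toFun a) (hy : 2 * D ≤ dist p y ∨ y = c.toFun b)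
    (hxy : dist x y ≤ 4 * D) :
    ∃ i ≤ c.len, dist p (c.toFun i) ≤ δ * n + 2 * lam := by
  have hδn : 0 ≤ δ * n := by positivity
  have hba : b - a + 2 ≤ 2 ^ n := by
    have h1 := hc.sub_le hlam hab hb
    have h2 : dist (c.toFun a) (c.toFun b) ≤ 6 * D := by
      have := dist_triangle4 (c.toFun a) x y (c.toFun b)
      rw [dist_comm] at hxa
      linarith
    have h3 : lam * (dist (c.toFun a) (c.toFun b) + lam) ≤ lam * (6 * D + lam) := by gcongr
    have h4 : ((b - a + 2 : ℕ) : ℝ) ≤ ((2 ^ n : ℕ) : ℝ) := by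
      push_cast [hab]
      linarith
    exact_mod_cast h4
  set f : ℕ → X := fun j => if j = 0 then x else if j ≤ b - a + 1 then c.toFun (a + j - 1) else y
    with hf
  have f0 : f 0 = x := by simp [hf]
  have f1 : ∀ j, 1 ≤ j → j ≤ b - a + 1 → f j = c.toFun (a + j - 1) := by
    intro j h1 h2
    simp only [hf]
    rw [if_neg (by omega), if_pos h2]
  have f2 : ∀ j, b - a + 2 ≤ j → f j = y := by
    intro j h1
    simp only [hf]
    rw [if_neg (by omega), if_neg (by omega)]
  obtain ⟨i, hi, T, hT, q, hq, hpq⟩ := hX.exists_near_chain n f S (by rwa [f0, f2 _ hba]) p hp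
  have hadd := hT.dist_add_dist hq
  rcases Nat.eq_zero_or_pos i with rfl | hi0
  · rw [f0, f1 _ le_rfl (by omega)] at hadd
    simp only [Nat.add_sub_cancel] at hadd
    rcases hx with hx | hx
    · have := dist_triangle_right p x q
      linarith [dist_nonneg (x := q) (y := c.toFun a)]
    · refine ⟨a, by omega, ?_⟩
      rw [← hx, dist_self] at hadd
      rw [← hx]
      linarith [dist_triangle p q x, dist_nonneg (x := x) (y := q)]
  rcases Nat.lt_or_ge i (b - a + 1) with h | h
  · rw [f1 _ hi0 (by omega), f1 _ (by omega) (by omega)] at hadd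
    refine ⟨a + i - 1, by omega, ?_⟩
    have h3 := hc.dist_succ_le (t := a + i - 1) (by omega)
    rw [show a + i - 1 + 1 = a + (i + 1) - 1 by omega] at h3
    have := dist_triangle_right p (c.toFun (a + i - 1)) q
    linarith [dist_nonneg (x := q) (y := c.toFun (a + (i + 1) - 1))]
  · have hqy : dist q y ≤ dist y (c.toFun b) := by
      rcases h.eq_or_lt with h | h
      · rw [f1 _ hi0 (by omega), f2 _ (by omega), show a + i - 1 = b by omega] at hadd
        rw [dist_comm y]
        linarith [dist_nonneg (x := c.toFun b) (y := q)]
      · rw [f2 _ (by omega), f2 _ (by omega), dist_self] at hadd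
        linarith [dist_nonneg (x := y) (y := q), dist_nonneg (x := y) (y := c.toFun b)]
    rcases hy with hy | hy
    · linarith [dist_triangle p q y]
    · refine ⟨b, hb, ?_⟩
      rw [← hy, dist_self] at hqy
      rw [← hy]
      linarith [dist_triangle p q y]

theorem IsQuasigeodesic.geodesic_near_improve {δ : ℝ} (hX : IsRipsHyperbolic X δ) (hδ : 0 ≤ δ)
    (hlam : 1 ≤ lam) (hc : c.IsQuasigeodesic lam) {D : ℝ} {n : ℕ}
    (hn : lam * (6 * D + lam) + 2 ≤ (2 : ℝ) ^ n) (hD : δ * n < D)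
    {l : ℝ} {g : ℝ → X} (h0 : g 0 = c.toFun 0) (h1 : g l = c.toFun c.len)
    (hg : ∀ s ∈ Set.Icc 0 l, ∀ t ∈ Set.Icc 0 l, dist (g s) (g t) = |s - t|)
    (H : ∀ u ∈ Set.Icc 0 l, ∃ i ≤ c.len, dist (g u) (c.toFun i) ≤ D) :
    ∀ u ∈ Set.Icc 0 l, ∃ i ≤ c.len, dist (g u) (c.toFun i) ≤ δ * n + 2 * lam := by
  intro u hu
  have hδn : 0 ≤ δ * n := by positivity
  obtain ⟨u₁, h10, h1u, hu1, a, ha, hda, hoa⟩ : ∃ u₁, 0 ≤ u₁ ∧ u₁ ≤ u ∧ u ≤ u₁ + 2 * D ∧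
      ∃ a ≤ c.len, dist (g u₁) (c.toFun a) ≤ D ∧
        (2 * D ≤ dist (g u) (g u₁) ∨ g u₁ = c.toFun a) := by
    rcases le_total (u - 2 * D) 0 with h | h
    · exact ⟨0, le_rfl, hu.1, by linarith, 0, by omega, by rw [h0, dist_self]; linarith,
        Or.inr h0⟩
    · obtain ⟨a, ha, hda⟩ := H (u - 2 * D) ⟨h, by linarith [hu.2]⟩
      refine ⟨u - 2 * D, h, by linarith, by linarith, a, ha, hda, Or.inl ?_⟩
      rw [hg u hu _ ⟨h, by linarith [hu.2]⟩, abs_of_nonneg (by linarith)]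
      linarith
  obtain ⟨u₂, h20, h2u, hu2, b, hb, hdb, hob⟩ : ∃ u₂, u₂ ≤ l ∧ u ≤ u₂ ∧ u₂ ≤ u + 2 * D ∧
      ∃ b ≤ c.len, dist (g u₂) (c.toFun b) ≤ D ∧
        (2 * D ≤ dist (g u) (g u₂) ∨ g u₂ = c.toFun b) := by
    rcases le_total l (u + 2 * D) with h | h
    · exact ⟨l, le_rfl, hu.2, by linarith, c.len, le_rfl, by rw [h1, dist_self]; linarith,
        Or.inr h1⟩
    · obtain ⟨b, hb, hdb⟩ := H (u + 2 * D) ⟨by linarith [hu.1], h⟩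
      refine ⟨u + 2 * D, h, by linarith, by linarith, b, hb, hdb, Or.inl ?_⟩
      rw [hg u hu _ ⟨by linarith [hu.1], h⟩, abs_of_nonpos (by linarith)]
      linarith
  have hS := isGeodesicSegment_image_Icc hg h10 (h1u.trans h2u) h20
  have hp : g u ∈ g '' Set.Icc u₁ u₂ := ⟨u, ⟨h1u, h2u⟩, rfl⟩
  have h12 : dist (g u₁) (g u₂) ≤ 4 * D := by
    rw [hg _ ⟨h10, by linarith⟩ _ ⟨by linarith, h20⟩, abs_of_nonpos (by linarith)]
    linarith
  rcases le_total a b with hab | hab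
  · exact hc.exists_dist_le_of_chain hX hδ hlam hn hD hS hp hab hb hda hdb hoa hob h12
  · exact hc.exists_dist_le_of_chain hX hδ hlam hn hD hS.symm hp hab ha hdb hda hob hoa
      (by rwa [dist_comm])

theorem exists_forall_geodesic_near (δ lam : ℝ) (hδ : 0 ≤ δ) (hlam : 1 ≤ lam) :
    ∃ H : ℝ, 0 ≤ H ∧ ∀ (X : Type*) [MetricSpace X], IsRipsHyperbolic X δ →
      ∀ c : DottedPath X, c.IsQuasigeodesic lam → ∀ (l : ℝ) (g : ℝ → X), 0 ≤ l →
      g 0 = c.toFun 0 → g l = c.toFun c.len →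
      (∀ s ∈ Set.Icc 0 l, ∀ t ∈ Set.Icc 0 l, dist (g s) (g t) = |s - t|) →
      ∀ u ∈ Set.Icc 0 l, ∃ i ≤ c.len, dist (g u) (c.toFun i) ≤ H := by
  set b : ℝ := 2 * lam + δ + 1 with hb
  obtain ⟨n₀, hn₀⟩ := exists_linear_le_two_pow (lam * 6 * (δ + 1)) (lam * (6 * b + lam) + 2)
  refine ⟨(δ + 1) * n₀ + b, by positivity, ?_⟩
  intro X _ hX c hc l g hl h0 h1 hg
  have key : ∀ k : ℕ, (∀ u ∈ Set.Icc 0 l, ∃ i ≤ c.len,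
      dist (g u) (c.toFun i) ≤ (δ + 1) * (n₀ + k : ℕ) + b) →
      ∀ u ∈ Set.Icc 0 l, ∃ i ≤ c.len, dist (g u) (c.toFun i) ≤ (δ + 1) * n₀ + b := by
    intro k
    induction k with
    | zero => exact fun h => h
    | succ k ih =>
      intro H
      refine ih fun u hu => ?_
      have e1 := hn₀ (n₀ + (k + 1)) (by omega)
      have e2 : (0 : ℝ) ≤ ((n₀ + (k + 1) : ℕ) : ℝ) := by positivity
      obtain ⟨i, hi, hd⟩ := hc.geodesic_near_improve hX hδ hlam
        (D := (δ + 1) * (n₀ + (k + 1) : ℕ) + b) (n := n₀ + (k + 1)) (by linarith) (by linarith)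
        h0 h1 hg H u hu
      refine ⟨i, hi, hd.trans ?_⟩
      push_cast
      have : (0 : ℝ) ≤ (n₀ : ℝ) + k := by positivity
      linarith
  obtain ⟨k, hk⟩ := exists_nat_ge l
  refine key k fun u hu => ⟨0, by omega, ?_⟩
  rw [← h0, hg u hu 0 ⟨le_rfl, hl⟩, abs_of_nonneg (by linarith [hu.1])]
  push_cast
  nlinarith [hu.2, mul_nonneg hδ (Nat.cast_nonneg (α := ℝ) n₀),
    mul_nonneg hδ (Nat.cast_nonneg (α := ℝ) k), Nat.cast_nonneg (α := ℝ) n₀]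

/-- Quasigeodesics in a hyperbolic space lie uniformly close to geodesics with the same
end points. -/
theorem exists_forall_quasigeodesic_near (δ lam : ℝ) (hδ : 0 ≤ δ) (hlam : 1 ≤ lam) :
    ∃ H : ℝ, 0 ≤ H ∧ ∀ (X : Type*) [MetricSpace X], IsRipsHyperbolic X δ →
      ∀ c : DottedPath X, c.IsQuasigeodesic lam → ∀ (S : Set X),
      IsGeodesicSegment S (c.toFun 0) (c.toFun c.len) →
      ∀ t ≤ c.len, ∃ q ∈ S, dist (c.toFun t) q ≤ H := by
  obtain ⟨D, hD, h⟩ := exists_forall_geodesic_near δ lam hδ hlam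
  refine ⟨D + (lam * (lam * (2 * D + 1 + lam)) + lam), by positivity, ?_⟩
  intro X _ hX c hc S hS t ht
  obtain ⟨l, g, hl, h0, h1, hg, rfl⟩ := hS
  have near := h X hX c hc l g hl h0 h1 hg
  obtain ⟨a, b, hat, htb, hb, v, hv, hva, hab⟩ : ∃ a b, a ≤ t ∧ t ≤ b ∧ b ≤ c.len ∧
      ∃ v ∈ Set.Icc 0 l, dist (g v) (c.toFun a) ≤ D ∧
        dist (c.toFun a) (c.toFun b) ≤ 2 * D + 1 := by
    obtain ⟨L, hL⟩ := exists_nat_ge l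
    have hm : ∀ k : ℕ, min (k : ℝ) l ∈ Set.Icc 0 l := fun k =>
      ⟨le_min (by positivity) hl, min_le_right _ _⟩
    by_cases hQ : ∃ k : ℕ, ¬ ∃ a ≤ t, dist (g (min (k : ℝ) l)) (c.toFun a) ≤ D
    · classical
      have hk := Nat.find_spec hQ
      have hk' := fun j hj => Nat.find_min hQ (m := j) hj
      set k := Nat.find hQ
      have hk0 : k ≠ 0 := by
        intro hk0
        apply hk
        rw [hk0]
        exact ⟨0, by omega, by simp [min_eq_left hl, h0, hD]⟩
      obtain ⟨j, hj⟩ := Nat.exists_eq_succ_of_ne_zero hk0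
      obtain ⟨a, ha, hda⟩ := not_not.1 (hk' j (by omega))
      obtain ⟨b, hb, hdb⟩ := near _ (hm k)
      have hbt : t < b := by
        by_contra hbt
        exact hk ⟨b, by omega, hdb⟩
      refine ⟨a, b, ha, hbt.le, hb, _, hm j, hda, ?_⟩
      have : dist (g (min (j : ℝ) l)) (g (min (k : ℝ) l)) ≤ 1 := by
        rw [hg _ (hm j) _ (hm k)]
        refine (abs_min_sub_min_le_max _ _ _ _).trans ?_
        rw [hj]
        simp
      have h4 := dist_triangle4 (c.toFun a) (g (min (j : ℝ) l)) (g (min (k : ℝ) l)) (c.toFun b)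
      rw [dist_comm (c.toFun a) (g _)] at h4
      linarith
    · push Not at hQ
      obtain ⟨a, ha, hda⟩ := hQ L
      rw [min_eq_right hL] at hda
      refine ⟨a, c.len, ha, ht, le_rfl, l, ⟨hl, le_rfl⟩, hda, ?_⟩
      rw [← h1, dist_comm]
      linarith
  refine ⟨g v, ⟨v, hv, rfl⟩, ?_⟩
  have e1 := hc.sub_le hlam (hat.trans htb) hb
  have e2 := hc.dist_le hat ht
  have e3 : (t : ℝ) ≤ b := by exact_mod_cast htb
  have e4 : lam * (dist (c.toFun a) (c.toFun b) + lam) ≤ lam * (2 * D + 1 + lam) := by gcongr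
  have e5 : lam * ((t : ℝ) - a) ≤ lam * (lam * (2 * D + 1 + lam)) := by
    gcongr
    linarith
  have e6 := dist_triangle (c.toFun t) (c.toFun a) (g v)
  rw [dist_comm (c.toFun t) (c.toFun a), dist_comm (c.toFun a) (g v)] at e6
  linarith

end DottedPath

/-! ### Approximate nearest point projections -/

namespace IsApproxProj

variable {X : Type*} [MetricSpace X] {A : Set X} {ε ε' r : ℝ} {x y z : X}

theorem mono (h : IsApproxProj ε A x y) (hε : ε ≤ ε') : IsApproxProj ε' A x y :=
  ⟨h.1, fun z hz => by linarith [h.2 z hz]⟩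

theorem of_between (h : IsApproxProj ε A x y) {q : X} (hq : dist x q + dist q y = dist x y) :
    IsApproxProj ε A q y :=
  ⟨h.1, fun z hz => by linarith [h.2 z hz, dist_triangle x q z]⟩

theorem of_dist_source_le (h : IsApproxProj ε A x y) {q : X} (hq : dist x q ≤ r) :
    IsApproxProj (ε + 2 * r) A q y :=
  ⟨h.1, fun z hz => by
    linarith [h.2 z hz, dist_triangle x q z, dist_triangle q x y, dist_comm q x]⟩

theorem of_dist_target_le (h : IsApproxProj ε A x y) (hz : z ∈ A) (hyz : dist y z ≤ r) :
    IsApproxProj (ε + r) A x z :=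
  ⟨hz, fun w hw => by linarith [h.2 w hw, dist_triangle x y z]⟩

end IsApproxProj

/-- The defect in the reverse triangle inequality for `ε`-approximate projections on
`K`-quasiconvex subsets of `δ`-hyperbolic spaces. -/
noncomputable def projConst (δ K ε : ℝ) : ℝ := 2 * (3 * δ + K + ε + 1)

section Projections

variable {X : Type*} [MetricSpace X] {A : Set X} {δ K ε ε' r : ℝ} {x b z : X}

theorem IsApproxProj.dist_add_dist_le (hX : IsRipsHyperbolic X δ) (hδ : 0 ≤ δ) (hK : 0 ≤ K)
    (hε : 0 ≤ ε) (hA : IsQuasiconvex K A) (h : IsApproxProj ε A x b) (hz : z ∈ A) :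
    dist x b + dist b z ≤ dist x z + projConst δ K ε := by
  unfold projConst
  rcases le_total (dist b z) (2 * δ + K + ε + 1) with hbz | hbz
  · linarith [dist_triangle x z b, dist_comm z b]
  obtain ⟨S, hS⟩ := hX.1 x b
  obtain ⟨T, hT⟩ := hX.1 b z
  obtain ⟨U, hU⟩ := hX.1 x z
  obtain ⟨w, hw, hbw⟩ := hT.exists_dist_eq (by positivity) hbz
  obtain ⟨v, hv, hwv⟩ := (hX.2 _ _ _ _ _ _ hS hT hU).2.1 hw
  rcases hv with hv | hv
  · obtain ⟨a, ha, hwa⟩ := hA b h.1 z hz T hT hw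
    have h1 := (h.of_between (hS.dist_add_dist hv)).2 a ha
    linarith [dist_triangle v w a, dist_triangle w v b, dist_comm v w, dist_comm w b]
  · have h1 := hU.dist_add_dist hv
    linarith [dist_triangle x v b, dist_triangle b v z, dist_triangle b w v, dist_comm v b]

theorem IsApproxProj.dist_add_dist_le_of_mem_nbhd (hX : IsRipsHyperbolic X δ) (hδ : 0 ≤ δ)
    (hK : 0 ≤ K) (hε : 0 ≤ ε) (hA : IsQuasiconvex K A) (h : IsApproxProj ε A x b)
    (hz : z ∈ nbhd r A) : dist x b + dist b z ≤ dist x z + (projConst δ K ε + 2 * r) := by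
  obtain ⟨a, ha, hza⟩ := hz
  linarith [h.dist_add_dist_le hX hδ hK hε hA ha, dist_triangle x z a, dist_triangle b a z,
    dist_comm a z]

theorem IsApproxProj.dist_add_dist_le_of_meets_nbhd (hX : IsRipsHyperbolic X δ) (hδ : 0 ≤ δ)
    (hK : 0 ≤ K) (hε : 0 ≤ ε) (hA : IsQuasiconvex K A) (h : IsApproxProj ε A x b) {S : Set X}
    (hS : IsGeodesicSegment S x z) (hSA : (S ∩ nbhd r A).Nonempty) :
    dist x b + dist b z ≤ dist x z + (projConst δ K ε + 2 * r) := by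
  obtain ⟨w, hw, hwA⟩ := hSA
  linarith [h.dist_add_dist_le_of_mem_nbhd hX hδ hK hε hA hwA, hS.dist_add_dist hw,
    dist_triangle b w z]

theorem IsApproxProj.dist_le (hX : IsRipsHyperbolic X δ) (hδ : 0 ≤ δ) (hK : 0 ≤ K)
    (hε : 0 ≤ ε) (hA : IsQuasiconvex K A) (h : IsApproxProj ε A x b) (h' : IsApproxProj ε' A x z) :
    dist b z ≤ projConst δ K ε + ε' := by
  linarith [h.dist_add_dist_le hX hδ hK hε hA h'.1, h'.2 b h.1]

theorem exists_isApproxProj (hA : A.Nonempty) (hε : 0 < ε) (x : X) : ∃ y, IsApproxProj ε A x y := by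
  obtain ⟨y, hy, hxy⟩ := (Metric.infDist_lt_iff hA (x := x)).1 (lt_add_of_pos_right _ hε)
  exact ⟨y, hy, fun z hz => by linarith [Metric.infDist_le_dist_of_mem hz (x := x)]⟩

theorem exists_isApproxProjMap (hA : A.Nonempty) (hε : 0 < ε) :
    ∃ f : X → X, IsApproxProjMap ε A f := by
  classical
  choose g hg using fun x : X => exists_isApproxProj hA hε x
  refine ⟨fun x => if x ∈ A then x else g x, fun a ha => if_pos ha, fun x => ?_⟩
  by_cases hx : x ∈ A
  · simp only [hx, if_true]
    exact ⟨hx, fun z _ => by rw [dist_self]; positivity⟩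
  · simpa only [hx, if_false] using hg x

theorem Cobounded.dist_le {D : ℝ} {B : Set X} (hX : IsRipsHyperbolic X δ) (hδ : 0 ≤ δ)
    (hK : 0 ≤ K) (hε : 0 ≤ ε) (hε' : 0 ≤ ε') (hB : IsQuasiconvex K B) (hAB : Cobounded D A B)
    {a a' b b' : X} (ha : a ∈ A) (ha' : a' ∈ A) (hb : IsApproxProj ε B a b)
    (hb' : IsApproxProj ε' B a' b') :
    dist b b' ≤ D + projConst δ K ε + projConst δ K ε' + 2 := by
  obtain ⟨f, hf⟩ := exists_isApproxProjMap (ε := 1) ⟨b, hb.1⟩ one_pos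
  have h1 := hb.dist_le hX hδ hK hε hB (hf.2 a)
  have h2 := hb'.dist_le hX hδ hK hε' hB (hf.2 a')
  have h3 := hAB.1 f hf a ha a' ha'
  linarith [dist_triangle4 b (f a) (f a') b', dist_comm b' (f a')]

end Projections

/-! ### Geometry of slab decompositions -/

namespace IsSlabDecomposition

variable {X : Type*} [MetricSpace X] {δ K D ε : ℝ} {R : ℝ → ℝ} {Y : Set X} {I : Set ℝ}
  {p : X → ℝ} {m n k : ℤ}

theorem mem_of_le_of_le (h : IsSlabDecomposition K R Y I p) (hm : (m : ℝ) ∈ I) (hn : (n : ℝ) ∈ I)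
    (hmk : m ≤ k) (hkn : k ≤ n) : (k : ℝ) ∈ I :=
  h.interval.2.1.out hm hn ⟨by exact_mod_cast hmk, by exact_mod_cast hkn⟩

theorem mem_interior_of_lt_of_lt (h : IsSlabDecomposition K R Y I p) (hm : (m : ℝ) ∈ I)
    (hn : (n : ℝ) ∈ I) (hmk : m < k) (hkn : k < n) : (k : ℝ) ∈ interior I :=
  mem_interior.2 ⟨Set.Ioo m n, fun _ ht => h.interval.2.1.out hm hn ⟨ht.1.le, ht.2.le⟩, isOpen_Ioo,
    by exact_mod_cast hmk, by exact_mod_cast hkn⟩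

theorem geodesic_meets_nbhd_fibre (h : IsSlabDecomposition K R Y I p) (hm : (m : ℝ) ∈ I)
    (hn : (n : ℝ) ∈ I) (hmk : m < k) (hkn : k < n) {x z : X} (hx : x ∈ Y) (hxk : p x ≤ k)
    (hz : z ∈ Y) (hzk : k ≤ p z) {S : Set X} (hS : IsGeodesicSegment S x z) :
    (S ∩ nbhd (max (R 1) 0) (fibre Y p k)).Nonempty := by
  obtain ⟨l, c, hl, h0, h1, hd, rfl⟩ := hS
  have hm : ∀ t : ℕ, min (t : ℝ) l ∈ Set.Icc 0 l := fun t =>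
    ⟨le_min (by positivity) hl, min_le_right _ _⟩
  have key : ∀ s t : ℕ, s ≤ t → t ≤ ⌈l⌉₊ →
      (t : ℝ) - s - 1 ≤ dist (c (min (s : ℝ) l)) (c (min (t : ℝ) l)) ∧
        dist (c (min (s : ℝ) l)) (c (min (t : ℝ) l)) ≤ (t : ℝ) - s + 1 := by
    intro s t hst ht
    have hst' : (s : ℝ) ≤ t := by exact_mod_cast hst
    have ht' : (t : ℝ) ≤ ⌈l⌉₊ := by exact_mod_cast ht
    have hc := Nat.ceil_lt_add_one hl
    rw [hd _ (hm s) _ (hm t), abs_of_nonpos (by linarith [min_le_min_right l hst'])]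
    rcases le_total (s : ℝ) l with h1 | h1 <;> rcases le_total (t : ℝ) l with h2 | h2 <;>
      simp only [min_eq_left, min_eq_right, h1, h2] <;> constructor <;> linarith
  obtain ⟨q, ⟨t, ht, rfl⟩, a, ha, hqa⟩ := (h.bisects k (h.mem_interior_of_lt_of_lt ‹_› hn hmk
    hkn)).2.2.2 1 le_rfl x ⟨hx, hxk⟩ z ⟨hz, hzk⟩ ⟨⌈l⌉₊, fun t => c (min (t : ℝ) l)⟩ (by
      intro s hs t ht
      rcases le_total s t with hst | hst
      · have hst' : (s : ℝ) ≤ t := by exact_mod_cast hst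
        rw [abs_of_nonpos (by linarith)]
        have := key s t hst ht
        exact ⟨by linarith, by linarith⟩
      · have hst' : (t : ℝ) ≤ s := by exact_mod_cast hst
        rw [abs_of_nonneg (by linarith), dist_comm]
        have := key t s hst hs
        exact ⟨by linarith, by linarith⟩)
    ⟨by simpa [min_eq_left hl] using h0, by simpa [min_eq_right (Nat.le_ceil l)] using h1⟩
  exact ⟨_, ⟨_, hm t, rfl⟩, a, ha, hqa.trans (le_max_left _ _)⟩

theorem slab_index_le (h : IsSlabDecomposition K R Y I p) (hm : (m : ℝ) ∈ I) (hn : (n : ℝ) ∈ I)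
    {i j : ℤ} (hmi : m ≤ i) (hjn : j < n) {u v : X} (hu : u ∈ slab Y p i (i + 1))
    (hv : v ∈ slab Y p j (j + 1)) (huv : dist u v ≤ 2 * K + 1) : j ≤ i + 1 := by
  by_contra hij
  have h1 := h.far i j (h.mem_of_le_of_le hm hn hmi (by omega))
    (h.mem_of_le_of_le hm hn (by omega) (by omega)) (h.mem_of_le_of_le hm hn (by omega) (by omega))
    (by omega)
  have h2 : setDist (slab Y p i (i + 1)) (slab Y p j (j + 1)) ≤ dist u v :=
    csInf_le ⟨0, by rintro _ ⟨a, _, b, _, rfl⟩; exact dist_nonneg⟩ ⟨u, hu, v, hv, rfl⟩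
  linarith

theorem sub_le_dist (h : IsSlabDecomposition K R Y I p) (hX : IsRipsHyperbolic X δ) (hK : 0 ≤ K)
    (hm : (m : ℝ) ∈ I) (hn : (n : ℝ) ∈ I) (hmn : m < n) {a b : X} (ha : a ∈ slab Y p m n)
    (hb : b ∈ slab Y p m n) : p b - p a ≤ dist a b + 3 := by
  have index : ∀ u ∈ slab Y p m n, ∃ i : ℤ, m ≤ i ∧ i < n ∧ u ∈ slab Y p i (i + 1) := by
    intro u hu
    rcases lt_or_eq_of_le hu.2.2 with hlt | heq
    · refine ⟨⌊p u⌋, Int.le_floor.2 hu.2.1, Int.floor_lt.2 hlt, hu.1, Int.floor_le _, ?_⟩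
      push_cast
      exact (Int.lt_floor_add_one _).le
    · refine ⟨n - 1, by omega, by omega, hu.1, ?_, ?_⟩ <;> push_cast <;> linarith
  obtain ⟨i₀, hi₀, hi₀', hai⟩ := index a ha
  obtain ⟨S, hS⟩ := hX.1 a b
  have hqc := h.slab_quasiconvex m n hm hn hmn a ha b hb S hS
  obtain ⟨l, c, hl, h0, h1, hd, rfl⟩ := hS
  have hmem : ∀ t : ℕ, min (t : ℝ) l ∈ Set.Icc 0 l := fun t =>
    ⟨le_min (by positivity) hl, min_le_right _ _⟩
  have key : ∀ t : ℕ, ∃ q, ∃ i : ℤ, dist (c (min (t : ℝ) l)) q ≤ K ∧ m ≤ i ∧ i < n ∧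
      q ∈ slab Y p i (i + 1) ∧ i ≤ i₀ + t := by
    intro t
    induction t with
    | zero => exact ⟨a, i₀, by simp [min_eq_left hl, h0, hK], hi₀, hi₀', hai, by simp⟩
    | succ t ih =>
      obtain ⟨q, i, hq, hi, hi', hqi, hit⟩ := ih
      obtain ⟨q', hq', hdq⟩ := hqc ⟨_, hmem (t + 1), rfl⟩
      obtain ⟨j, hj, hj', hqj⟩ := index q' hq'
      have hstep : dist (c (min (t : ℝ) l)) (c (min ((t + 1 : ℕ) : ℝ) l)) ≤ 1 := by
        rw [hd _ (hmem t) _ (hmem (t + 1))]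
        refine (abs_min_sub_min_le_max _ _ _ _).trans ?_
        simp
      have hqq : dist q q' ≤ 2 * K + 1 := by
        have := dist_triangle4 q (c (min (t : ℝ) l)) (c (min ((t + 1 : ℕ) : ℝ) l)) q'
        rw [dist_comm q (c _)] at this
        linarith
      have := h.slab_index_le hm hn hi hj' hqi hqj hqq
      exact ⟨q', j, hdq, hj, hj', hqj, by push_cast; omega⟩
  obtain ⟨q, i, hq, hi, -, hqi, hit⟩ := key ⌈l⌉₊
  obtain ⟨j, -, hj', hbj⟩ := index b hb
  rw [min_eq_right (Nat.le_ceil l), h1] at hq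
  have hij := h.slab_index_le hm hn hi hj' hqi hbj (by rw [dist_comm]; linarith)
  have hl' : dist a b = l := by
    rw [← h0, ← h1, hd _ ⟨le_rfl, hl⟩ _ ⟨hl, le_rfl⟩, abs_of_nonpos (by linarith)]
    ring
  have e1 := Nat.ceil_lt_add_one hl
  have e2 : (j : ℝ) ≤ i₀ + ⌈l⌉₊ + 1 := by
    have : j ≤ i₀ + (⌈l⌉₊ : ℤ) + 1 := by omega
    exact_mod_cast this
  have e3 := hai.2.1
  have e4 := hbj.2.2
  push_cast at e4
  linarith

end IsSlabDecomposition

/-- The accuracy of the projection on the next fibre if the fibres are `D`-cobounded. -/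
noncomputable def coboundedConst (δ K D ε r : ℝ) : ℝ :=
  1 + (D + projConst δ K (1 + 2 * r) + projConst δ K ε + 2)

/-- The accuracy of the projection on the next fibre in terms of that on the preceding one. -/
noncomputable def stepConst (δ K ε r ε₁ : ℝ) : ℝ :=
  1 + (projConst δ K ε + (1 + (projConst δ K ε₁ + 2 * r)))

/-- The accuracy of iterated projections, starting from accuracy `ε'`. -/
noncomputable def chainConst (δ K D ε r ε' : ℝ) : ℝ :=
  max (max ε' (coboundedConst δ K D ε r))
    (stepConst δ K ε r (max ε' (coboundedConst δ K D ε r)))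

namespace IsSlabDecomposition

variable {X : Type*} [MetricSpace X] {δ K D ε : ℝ} {R : ℝ → ℝ} {Y : Set X} {I : Set ℝ}
  {p : X → ℝ} {m n k : ℤ}

theorem isApproxProj_of_cobounded (h : IsSlabDecomposition K R Y I p) (hX : IsRipsHyperbolic X δ)
    (hδ : 0 ≤ δ) (hK : 0 ≤ K) (hε : 0 ≤ ε) (hm : (m : ℝ) ∈ I) (hn : (n : ℝ) ∈ I) (hmk : m < k)
    (hkn : k < n) (hco : Cobounded D (fibre Y p k) (fibre Y p (k + 1))) {x b b' : X} (hx : x ∈ Y)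
    (hxk : p x ≤ k) (hb : b ∈ fibre Y p k) (hb' : IsApproxProj ε (fibre Y p (k + 1)) b b') :
    IsApproxProj (coboundedConst δ K D ε (max (R 1) 0)) (fibre Y p (k + 1)) x b' := by
  have hr : 0 ≤ max (R 1) 0 := le_max_right _ _
  obtain ⟨z, hz⟩ := exists_isApproxProj (ε := 1) ⟨b', hb'.1⟩ one_pos x
  obtain ⟨S, hS⟩ := hX.1 x z
  have hzp : (k : ℝ) ≤ p z := by
    rw [hz.1.2]
    push_cast
    linarith
  obtain ⟨w, hw, a, ha, hwa⟩ := h.geodesic_meets_nbhd_fibre hm hn hmk hkn hx hxk hz.1.1 hzp hS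
  have hza := (hz.of_between (hS.dist_add_dist hw)).of_dist_source_le hwa
  exact hz.of_dist_target_le hb'.1 (hco.dist_le hX hδ hK (by linarith) hε
    (h.fibre_quasiconvex _ (h.mem_of_le_of_le hm hn (by omega) (by omega))) ha hb hza hb')

theorem isApproxProj_succ (h : IsSlabDecomposition K R Y I p) (hX : IsRipsHyperbolic X δ)
    (hδ : 0 ≤ δ) (hK : 0 ≤ K) (hε : 0 ≤ ε) {ε₁ : ℝ} (hε₁ : 0 ≤ ε₁) (hm : (m : ℝ) ∈ I)
    (hn : (n : ℝ) ∈ I) (hmk : m < k) (hkn : k < n) {x b b' : X} (hx : x ∈ Y)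
    (hxk : p x ≤ k) (hb : IsApproxProj ε₁ (fibre Y p k) x b)
    (hb' : IsApproxProj ε (fibre Y p (k + 1)) b b') :
    IsApproxProj (stepConst δ K ε (max (R 1) 0) ε₁) (fibre Y p (k + 1)) x b' := by
  obtain ⟨z, hz⟩ := exists_isApproxProj (ε := 1) ⟨b', hb'.1⟩ one_pos x
  obtain ⟨S, hS⟩ := hX.1 x z
  have hzp : (k : ℝ) ≤ p z := by
    rw [hz.1.2]
    push_cast
    linarith
  have hqc := fun j (h₁ : m ≤ j) (h₂ : j ≤ n) =>
    h.fibre_quasiconvex j (h.mem_of_le_of_le hm hn h₁ h₂)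
  have hadd := hb.dist_add_dist_le_of_meets_nbhd hX hδ hK hε₁ (hqc k (by omega) (by omega)) hS
    (h.geodesic_meets_nbhd_fibre hm hn hmk hkn hx hxk hz.1.1 hzp hS)
  have hbz : IsApproxProj (1 + (projConst δ K ε₁ + 2 * max (R 1) 0)) (fibre Y p (k + 1)) b z :=
    ⟨hz.1, fun w hw => by linarith [hz.2 w hw, dist_triangle x b w]⟩
  refine hz.of_dist_target_le hb'.1 ?_
  rw [dist_comm]
  exact hb'.dist_le hX hδ hK hε (hqc _ (by omega) (by omega)) hbz

theorem isApproxProj_chain (h : IsSlabDecomposition K R Y I p) (hX : IsRipsHyperbolic X δ)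
    (hδ : 0 ≤ δ) (hK : 0 ≤ K) (hε : 0 ≤ ε) {ε' : ℝ} (hε' : 0 ≤ ε')
    (hm : (m : ℝ) ∈ I) (hn : (n : ℝ) ∈ I)
    (hco : ∀ i j : ℤ, m + 1 ≤ i → i < j → j ≤ n - 1 → Cobounded D (fibre Y p i) (fibre Y p j))
    {y : ℤ → X}
    (hy : ∀ i : ℤ, m ≤ i → i ≤ n - 1 → IsApproxProj ε (fibre Y p (i + 1)) (y i) (y (i + 1)))
    {i : ℤ} (hmi : m ≤ i) {x : X} (hx : x ∈ Y) (hxi : p x ≤ i + 1)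
    (hxy : IsApproxProj ε' (fibre Y p (i + 1)) x (y (i + 1))) (hik : i + 1 ≤ k) (hkn : k ≤ n) :
    IsApproxProj (chainConst δ K D ε (max (R 1) 0) ε') (fibre Y p k) x (y k) := by
  have before : ∀ k, i + 1 ≤ k → k ≤ n → (k = n → i + 1 = n) → IsApproxProj
      (max ε' (coboundedConst δ K D ε (max (R 1) 0))) (fibre Y p k) x (y k) := by
    intro k hik hkn hk
    rcases hik.eq_or_lt with rfl | hik
    · exact hxy.mono (le_max_left _ _)
    obtain ⟨k, rfl⟩ : ∃ j, k = j + 1 := ⟨k - 1, by omega⟩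
    have hxk : p x ≤ k := hxi.trans (by exact_mod_cast (by omega : i + 1 ≤ k))
    obtain ⟨j, rfl⟩ : ∃ j, k = j + 1 := ⟨k - 1, by omega⟩
    exact (h.isApproxProj_of_cobounded hX hδ hK hε hm hn (by omega) (by omega)
      (hco _ _ (by omega) (by omega) (by omega)) hx hxk (hy j (by omega) (by omega)).1
      (hy _ (by omega) (by omega))).mono (le_max_right _ _)
  by_cases hk : k = n ∧ i + 1 ≠ n
  · obtain ⟨k, rfl⟩ : ∃ j, k = j + 1 := ⟨k - 1, by omega⟩
    have hxk : p x ≤ k := hxi.trans (by exact_mod_cast (by omega : i + 1 ≤ k))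
    exact (h.isApproxProj_succ hX hδ hK hε (hε'.trans (le_max_left _ _)) hm hn (by omega) (by omega)
      hx hxk (before k (by omega) (by omega) (by omega)) (hy k (by omega) (by omega))).mono
      (le_max_right _ _)
  · exact (before k hik hkn (by omega)).mono (le_max_left _ _)

end IsSlabDecomposition

/-! ### Concatenations -/

namespace DottedPath

variable {X : Type*}

theorem Joins.end_mem_range {c : DottedPath X} {x y : X} (h : c.Joins x y) : y ∈ c.range :=
  ⟨c.len, le_rfl, h.2⟩

theorem Joins.concat {c c' : DottedPath X} {x y z : X} (h : c.Joins x y) (h' : c'.Joins y z) :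
    (c.concat c').Joins x z := by
  refine ⟨by simpa [DottedPath.concat] using h.1, ?_⟩
  simp only [DottedPath.concat]
  split_ifs with hl
  · rw [show c.len + c'.len = c.len by omega, h.2, ← h'.1, ← h'.2, show c'.len = 0 by omega]
  · rw [Nat.add_sub_cancel_left, h'.2]

theorem concatFrom_congr {α α' : ℤ → DottedPath X} {m : ℤ} {k : ℕ} (hk : 0 < k)
    (h : ∀ i : ℕ, i < k → α (m + i) = α' (m + i)) : concatFrom α m k = concatFrom α' m k := by
  have h0 : α m = α' m := by simpa using h 0 hk
  clear hk
  induction k with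
  | zero => simp [concatFrom, h0]
  | succ k ih =>
    simp only [concatFrom]
    rw [ih fun i hi => h i (by omega), h k (by omega)]

theorem Joins.concatFrom {α : ℤ → DottedPath X} {m : ℤ} {w : ℕ → X} {k : ℕ} (hk : 0 < k)
    (h : ∀ i : ℕ, i < k → (α (m + i)).Joins (w i) (w (i + 1))) :
    (concatFrom α m k).Joins (w 0) (w k) := by
  have h0 : (α m).toFun 0 = w 0 := by simpa using (h 0 hk).1
  clear hk
  induction k with
  | zero => exact ⟨h0, h0⟩
  | succ k ih => exact (ih fun i hi => h i (by omega)).concat (h k (by omega))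

theorem exists_of_le_concatFrom_len {α : ℤ → DottedPath X} {m : ℤ} {k t : ℕ} (hk : 0 < k)
    (ht : t ≤ (concatFrom α m k).len) :
    ∃ i < k, ∃ u ≤ (α (m + i)).len, t = (concatFrom α m i).len + u ∧
      (concatFrom α m k).toFun t = (α (m + i)).toFun u := by
  induction k with
  | zero => omega
  | succ k ih =>
    simp only [concatFrom, DottedPath.concat] at ht ⊢
    by_cases h : t ≤ (concatFrom α m k).len
    · rw [if_pos h]
      rcases Nat.eq_zero_or_pos k with rfl | hk
      · have ht0 : t = 0 := by simpa [concatFrom, const] using h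
        exact ⟨0, by omega, 0, by omega, by simp [ht0, concatFrom, const],
          by simp [concatFrom, const]⟩
      · obtain ⟨i, hi, u, hu, h1, h2⟩ := ih hk h
        exact ⟨i, by omega, u, hu, h1, h2⟩
    · rw [if_neg h]
      exact ⟨k, by omega, t - (concatFrom α m k).len, by omega, by omega, rfl⟩

theorem concatFrom_len_mono (α : ℤ → DottedPath X) (m : ℤ) :
    Monotone fun k => (concatFrom α m k).len :=
  monotone_nat_of_le_succ fun _ => Nat.le_add_right _ _

variable [MetricSpace X]

theorem dist_succ_concat_le {c c' : DottedPath X} {J : ℝ}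
    (hcc : c.toFun c.len = c'.toFun 0)
    (h : ∀ t, t + 1 ≤ c.len → dist (c.toFun t) (c.toFun (t + 1)) ≤ J)
    (h' : ∀ t, t + 1 ≤ c'.len → dist (c'.toFun t) (c'.toFun (t + 1)) ≤ J) :
    ∀ t, t + 1 ≤ (c.concat c').len →
      dist ((c.concat c').toFun t) ((c.concat c').toFun (t + 1)) ≤ J := by
  intro t ht
  simp only [concat] at ht ⊢
  rcases lt_trichotomy t c.len with hlt | rfl | hlt
  · rw [if_pos (by omega), if_pos (by omega)]
    exact h t hlt
  · rw [if_pos le_rfl, if_neg (by omega), hcc, show c.len + 1 - c.len = 0 + 1 by omega]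
    exact h' 0 (by omega)
  · rw [if_neg (by omega), if_neg (by omega), show t + 1 - c.len = t - c.len + 1 by omega]
    exact h' _ (by omega)

theorem dist_succ_concatFrom_le {α : ℤ → DottedPath X} {m : ℤ} {w : ℕ → X} {k : ℕ} {J : ℝ}
    (hw : ∀ i : ℕ, i < k → (α (m + i)).Joins (w i) (w (i + 1)))
    (h : ∀ i : ℕ, i < k → ∀ t, t + 1 ≤ (α (m + i)).len →
      dist ((α (m + i)).toFun t) ((α (m + i)).toFun (t + 1)) ≤ J) :
    ∀ t, t + 1 ≤ (concatFrom α m k).len →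
      dist ((concatFrom α m k).toFun t) ((concatFrom α m k).toFun (t + 1)) ≤ J := by
  induction k with
  | zero => intro t ht; simp [concatFrom, const] at ht
  | succ k ih =>
    refine dist_succ_concat_le ?_ (ih (fun i hi => hw i (by omega)) fun i hi => h i (by omega))
      (h k (by omega))
    rcases Nat.eq_zero_or_pos k with rfl | hk
    · simp [concatFrom, const]
    · rw [(Joins.concatFrom hk fun i hi => hw i (by omega)).2, (hw k (by omega)).1]

theorem isQuasigeodesic_of_sub_le {c : DottedPath X} {A B J : ℝ} (hA : 1 ≤ A) (hB : 0 ≤ B)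
    (hJ : 0 ≤ J) (hstep : ∀ t, t + 1 ≤ c.len → dist (c.toFun t) (c.toFun (t + 1)) ≤ J)
    (h : ∀ s t, s ≤ t → t ≤ c.len → (t : ℝ) - s ≤ A * dist (c.toFun s) (c.toFun t) + B) :
    c.IsQuasigeodesic (A + B + J) := by
  have upper : ∀ s k : ℕ, s + k ≤ c.len → dist (c.toFun s) (c.toFun (s + k)) ≤ J * k := by
    intro s k
    induction k with
    | zero => simp
    | succ k ih =>
      intro hk
      rw [← add_assoc] at hk ⊢
      push_cast
      linarith [ih (by omega), hstep (s + k) hk,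
        dist_triangle (c.toFun s) (c.toFun (s + k)) (c.toFun (s + k + 1))]
  have key : ∀ s t, s ≤ t → t ≤ c.len →
      ((t : ℝ) - s) / (A + B + J) - (A + B + J) ≤ dist (c.toFun s) (c.toFun t) ∧
      dist (c.toFun s) (c.toFun t) ≤ (A + B + J) * ((t : ℝ) - s) + (A + B + J) := by
    intro s t hst ht
    have hd := dist_nonneg (x := c.toFun s) (y := c.toFun t)
    constructor
    · rw [sub_le_iff_le_add, div_le_iff₀ (by linarith)]
      nlinarith [h s t hst ht, mul_nonneg hd hB, mul_nonneg hd hJ, mul_nonneg hB hJ,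
        mul_self_nonneg B, mul_self_nonneg J]
    · obtain ⟨k, rfl⟩ := Nat.exists_eq_add_of_le hst
      have hk : (0 : ℝ) ≤ k := by positivity
      have := upper s k ht
      push_cast
      nlinarith [mul_nonneg hk hB, mul_nonneg hk (by linarith : 0 ≤ A)]
  intro s hs t ht
  rcases le_total s t with hst | hst
  · have hst' : (s : ℝ) ≤ t := by exact_mod_cast hst
    rw [abs_of_nonpos (by linarith), neg_sub]
    exact key s t hst ht
  · have hst' : (t : ℝ) ≤ s := by exact_mod_cast hst
    rw [abs_of_nonneg (by linarith), dist_comm]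
    exact key t s hst hs

/-- A concatenation of quasigeodesics is a quasigeodesic if geodesics between distinct pieces pass
near all intermediate break points, and if these break points escape at a definite speed. -/
theorem isQuasigeodesic_concatFrom {α : ℤ → DottedPath X} {m : ℤ} {w : ℕ → X} {N : ℕ}
    {lam C M : ℝ} (hlam : 1 ≤ lam) (hC : 0 ≤ C) (hM : 0 ≤ M)
    (hq : ∀ i : ℕ, i ≤ N → (α (m + i)).IsQuasigeodesic lam)
    (hw : ∀ i : ℕ, i ≤ N → (α (m + i)).Joins (w i) (w (i + 1)))
    (hadd : ∀ i j : ℕ, i < j → j ≤ N → ∀ x ∈ (α (m + i)).range, ∀ z ∈ (α (m + j)).range,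
      dist x (w j) + dist (w j) z ≤ dist x z + C)
    (hfar : ∀ i j : ℕ, i < j → j ≤ N → ∀ x ∈ (α (m + i)).range, (j : ℝ) - i ≤ dist x (w j) + M) :
    (concatFrom α m (N + 1)).IsQuasigeodesic
      (lam * (1 + C + lam) + lam * (C + 2 * lam + (C + lam) * (C + M)) + 2 * lam) := by
  have h0 : (0 : ℝ) < lam := by linarith
  refine isQuasigeodesic_of_sub_le (by nlinarith) (by positivity) (by positivity)
    (dist_succ_concatFrom_le (fun i hi => hw i (by omega))
      fun i hi t ht => (hq i (by omega)).dist_succ_le ht) ?_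
  intro s t hst ht
  obtain ⟨i, hi, u, hu, hs, hsu⟩ := exists_of_le_concatFrom_len (Nat.succ_pos N) (hst.trans ht)
  obtain ⟨j, hj, v, hv, htv, htu⟩ := exists_of_le_concatFrom_len (Nat.succ_pos N) ht
  rw [hsu, htu]
  set x := (α (m + i)).toFun u with hx
  set z := (α (m + j)).toFun v with hz
  have hxr : x ∈ (α (m + i)).range := ⟨u, hu, rfl⟩
  have hzr : z ∈ (α (m + j)).range := ⟨v, hv, rfl⟩
  have hd := dist_nonneg (x := x) (y := z)
  have same : ∀ i u v : ℕ, u ≤ v → v ≤ (α (m + i)).len → i < N + 1 →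
      (v : ℝ) - u ≤ (lam * (1 + C + lam)) * dist ((α (m + i)).toFun u) ((α (m + i)).toFun v) +
        lam * (C + 2 * lam + (C + lam) * (C + M)) := by
    intro i u v huv hv hi
    have h1 := (hq i (by omega)).sub_le hlam huv hv
    refine h1.trans ?_
    rw [mul_assoc, ← mul_add]
    have hd := dist_nonneg (x := (α (m + i)).toFun u) (y := (α (m + i)).toFun v)
    have : 0 ≤ (C + lam) * (C + M) := by positivity
    gcongr
    · nlinarith
    · linarith
  rcases lt_trichotomy i j with hij | rfl | hij
  · have tele : ∀ k, i + 1 ≤ k → k ≤ j → ((concatFrom α m k).len : ℝ) - s ≤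
        lam * (dist x (w k) + lam + (C + lam) * ((k : ℝ) - i - 1)) := by
      intro k hk
      induction k, hk using Nat.le_induction with
      | base =>
        intro _
        have h1 := (hq i (by omega)).sub_le hlam hu le_rfl
        rw [(hw i (by omega)).2] at h1
        have h2 : (concatFrom α m (i + 1)).len = (concatFrom α m i).len + (α (m + i)).len := rfl
        rw [h2, hs]
        push_cast
        linarith
      | succ k hk ih =>
        intro hkj
        have h1 := ih (by omega)
        have h2 := (hq k (by omega)).sub_le hlam (Nat.zero_le _) le_rfl
        rw [(hw k (by omega)).1, (hw k (by omega)).2] at h2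
        have h3 := hadd i k (by omega) (by omega) x hxr _ (hw k (by omega)).end_mem_range
        have h4 : (concatFrom α m (k + 1)).len = (concatFrom α m k).len + (α (m + k)).len := rfl
        have h5 : lam * (dist (w k) (w (k + 1)) + lam) ≤
            lam * (dist x (w (k + 1)) - dist x (w k) + C + lam) := by
          gcongr
          linarith
        rw [h4]
        push_cast at h2 ⊢
        linarith
    have h1 := tele j (by omega) le_rfl
    have h2 := (hq j (by omega)).sub_le hlam (Nat.zero_le v) hv
    rw [(hw j (by omega)).1] at h2
    have h3 := hadd i j hij (by omega) x hxr z hzr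
    have h4 := hfar i j hij (by omega) x hxr
    have h5 := dist_nonneg (x := w j) (y := z)
    have h6 : (C + lam) * ((j : ℝ) - i - 1) ≤ (C + lam) * (dist x z + C + M) := by
      gcongr
      linarith
    rw [htv]
    push_cast at h2 ⊢
    calc ((concatFrom α m j).len : ℝ) + v - s
        ≤ lam * (dist x (w j) + lam + (C + lam) * ((j : ℝ) - i - 1)) +
          lam * (dist (w j) z + lam) := by linarith
      _ = lam * (dist x (w j) + dist (w j) z + 2 * lam + (C + lam) * ((j : ℝ) - i - 1)) := by ring
      _ ≤ lam * (dist x z + C + 2 * lam + (C + lam) * (dist x z + C + M)) := by gcongr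
      _ = _ := by ring
  · have := same i u v (by omega) hv hi
    rw [hs, htv]
    push_cast
    linarith
  · have h1 : (concatFrom α m (j + 1)).len ≤ (concatFrom α m i).len :=
      concatFrom_len_mono α m hij
    have h2 : (concatFrom α m (j + 1)).len = (concatFrom α m j).len + (α (m + j)).len := rfl
    have : (t : ℝ) = s := by exact_mod_cast (by omega : t = s)
    rw [this, sub_self]
    positivity

end DottedPath

theorem mainTheorem1 (δ K D ε : ℝ) (R : ℝ → ℝ)
    (hδ : 0 ≤ δ) (hK : 0 ≤ K) (hD : 0 ≤ D) (hε : 1 ≤ ε) :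
    ∃ μ : ℝ, 0 ≤ μ ∧ ∀ lam : ℝ, 1 ≤ lam → ∃ lam' : ℝ, 1 ≤ lam' ∧
      ∀ (X : Type*) [MetricSpace X], IsMetricGraph X → IsRipsHyperbolic X δ →
      ∀ (Y : Set X) (I : Set ℝ) (p : X → ℝ), IsSlabDecomposition K R Y I p →
      ∀ m n : ℤ, (m : ℝ) ∈ I → (n : ℝ) ∈ I → m < n →
      (∀ i j : ℤ, m + 1 ≤ i → i < j → j ≤ n - 1 → Cobounded D (fibre Y p i) (fibre Y p j)) →
      ∀ y : ℤ → X, y m ∈ fibre Y p m →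
      (∀ i : ℤ, m ≤ i → i ≤ n - 1 → IsApproxProj ε (fibre Y p (i + 1)) (y i) (y (i + 1))) →
      (∀ y' ∈ fibre Y p n, ∀ (α : ℤ → DottedPath X) (β : DottedPath X),
        (∀ i : ℤ, m ≤ i → i ≤ n - 1 →
          (α i).IsQuasigeodesic lam ∧ (α i).Joins (y i) (y (i + 1)) ∧
          (α i).range ⊆ slab Y p i (i + 1)) →
        β.IsQuasigeodesic lam → β.Joins (y n) y' →
        ((DottedPath.concatFrom α m (n - m).toNat).concat β).IsQuasigeodesic lam' ∧
        ((DottedPath.concatFrom α m (n - m).toNat).concat β).Joins (y m) y') ∧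
      (∀ i : ℤ, m + 2 ≤ i → i ≤ n → IsApproxProj μ (fibre Y p i) (y m) (y i)) := by
  have hε0 : 0 ≤ ε := by linarith
  set r := max (R 1) 0 with hr
  have hr0 : 0 ≤ r := le_max_right _ _
  have hchain : ∀ ε', ε' ≤ chainConst δ K D ε r ε' := fun ε' =>
    (le_max_left _ _).trans (le_max_left _ _)
  refine ⟨chainConst δ K D ε r ε, hε0.trans (hchain ε), fun lam hlam => ?_⟩
  obtain ⟨H, hH, near⟩ := DottedPath.exists_forall_quasigeodesic_near δ lam hδ hlam
  set μ' := chainConst δ K D ε r (ε + 2 * H) with hμ'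
  have hμ0 : 0 ≤ μ' := le_trans (by positivity) (hchain (ε + 2 * H))
  set C := projConst δ K μ' + 2 * max r (H + K) with hCdef
  have hC : 0 ≤ C := by
    have : 0 ≤ max r (H + K) := le_max_of_le_left hr0
    rw [hCdef, projConst]
    positivity
  refine ⟨lam * (1 + C + lam) + lam * (C + 2 * lam + (C + lam) * (C + 4)) + 2 * lam, ?_, ?_⟩
  · have : 0 ≤ lam * (1 + C + lam) + lam * (C + 2 * lam + (C + lam) * (C + 4)) := by positivity
    linarith
  intro X _ _ hX Y I p h m n hm hn hmn hco y hym hy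
  have hfib : ∀ i, m ≤ i → i ≤ n → y i ∈ fibre Y p i := by
    intro i hmi hin
    rcases hmi.eq_or_lt with rfl | hmi
    · exact hym
    · have := (hy (i - 1) (by omega) (by omega)).1
      rwa [sub_add_cancel] at this
  refine ⟨?_, ?_⟩
  swap
  · intro i hmi hin
    exact h.isApproxProj_chain hX hδ hK hε0 hε0 hm hn hco hy le_rfl hym.1 (by rw [hym.2]; linarith)
      (hy m le_rfl (by omega)) (by omega) hin
  intro y' hy' α β hα hβ hβj
  obtain ⟨N, rfl⟩ : ∃ N : ℕ, n = m + N := ⟨(n - m).toNat, by omega⟩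
  have hN : 0 < N := by omega
  rw [show (m + (N : ℤ) - m).toNat = N by omega]
  set α' : ℤ → DottedPath X := fun i => if i = m + N then β else α i with hα'
  have hα'n : α' (m + N) = β := by simp [hα']
  have hα'i : ∀ i : ℕ, i < N → α' (m + i) = α (m + i) := by
    intro i hi
    simp only [hα']
    rw [if_neg (by omega)]
  set w : ℕ → X := fun i => if i = N + 1 then y' else y (m + i) with hwdef
  have hwN : w (N + 1) = y' := by simp [hwdef]
  have hwi : ∀ i : ℕ, i ≤ N → w i = y (m + i) := by
    intro i hi
    simp only [hwdef]
    rw [if_neg (by omega)]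
  have hcat : (DottedPath.concatFrom α m N).concat β = DottedPath.concatFrom α' m (N + 1) := by
    rw [DottedPath.concatFrom, hα'n, DottedPath.concatFrom_congr hN hα'i]
  have hjoin : ∀ i : ℕ, i ≤ N → (α' (m + i)).Joins (w i) (w (i + 1)) := by
    intro i hi
    rcases hi.eq_or_lt with rfl | hi
    · rw [hα'n, hwN, hwi _ le_rfl]
      exact hβj
    · rw [hα'i i hi, hwi i hi.le, hwi (i + 1) hi]
      have := (hα (m + i) (by omega) (by omega)).2.1
      rwa [add_assoc] at this
  have hqg : ∀ i : ℕ, i ≤ N → (α' (m + i)).IsQuasigeodesic lam := by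
    intro i hi
    rcases hi.eq_or_lt with rfl | hi
    · rwa [hα'n]
    · rw [hα'i i hi]
      exact (hα (m + i) (by omega) (by omega)).1
  have hslab : ∀ i : ℕ, i < N → ∀ x ∈ (α' (m + i)).range, x ∈ slab Y p (m + i) (m + i + 1) := by
    intro i hi x hx
    rw [hα'i i hi] at hx
    exact (hα (m + i) (by omega) (by omega)).2.2 hx
  have hproj : ∀ i j : ℕ, i < j → j ≤ N → ∀ x ∈ (α' (m + i)).range,
      IsApproxProj μ' (fibre Y p (m + j)) x (w j) := by
    intro i j hij hj x hx
    have hxs := hslab i (by omega) x hx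
    have hqi := hqg i (by omega)
    have hji := hjoin i (by omega)
    obtain ⟨t, ht, rfl⟩ := hx
    obtain ⟨S, hS⟩ := hX.1 ((α' (m + i)).toFun 0) ((α' (m + i)).toFun (α' (m + i)).len)
    obtain ⟨q, hq, htq⟩ := near X hX _ hqi S hS t ht
    rw [hji.1, hji.2, hwi i (by omega), hwi (i + 1) (by omega)] at hS
    have hyi := hy (m + i) (by omega) (by omega)
    have hS' : IsGeodesicSegment S (y (m + i)) (y (m + i + 1)) := by
      simpa [add_assoc] using hS
    rw [hwi j hj]
    refine h.isApproxProj_chain hX hδ hK hε0 (by positivity) hm hn hco hy (i := m + i) (by omega)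
      hxs.1 (by exact_mod_cast hxs.2.2) ?_ (by omega) (by omega)
    exact (hyi.of_between (hS'.dist_add_dist hq)).of_dist_source_le (by rwa [dist_comm])
  have hqc : ∀ j : ℕ, j ≤ N → IsQuasiconvex K (fibre Y p (m + j)) := fun j hj =>
    h.fibre_quasiconvex _ (h.mem_of_le_of_le hm hn (by omega) (by omega))
  rw [hcat]
  refine ⟨DottedPath.isQuasigeodesic_concatFrom hlam hC (by norm_num) hqg hjoin ?_ ?_, ?_⟩
  · intro i j hij hj x hx z hz
    have hpr := hproj i j hij hj x hx
    rcases hj.eq_or_lt with rfl | hjN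
    · have hz' : z ∈ nbhd (H + K) (fibre Y p (m + j)) := by
        rw [hα'n] at hz
        obtain ⟨t, ht, rfl⟩ := hz
        obtain ⟨S, hS⟩ := hX.1 (β.toFun 0) (β.toFun β.len)
        obtain ⟨q, hq, htq⟩ := near X hX _ hβ S hS t ht
        rw [hβj.1, hβj.2] at hS
        obtain ⟨a, ha, hqa⟩ := hqc j le_rfl _ (hfib _ (by omega) le_rfl) _ hy' S hS hq
        exact ⟨a, ha, by linarith [dist_triangle (β.toFun t) q a]⟩
      have h1 := hpr.dist_add_dist_le_of_mem_nbhd hX hδ hK hμ0 (hqc j le_rfl) hz'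
      linarith [le_max_right r (H + K)]
    · have hxs := hslab i (by omega) x hx
      have hzs := hslab j hjN z hz
      obtain ⟨S, hS⟩ := hX.1 x z
      have hxj : p x ≤ ((m + j : ℤ) : ℝ) :=
        hxs.2.2.trans (by exact_mod_cast (by omega : m + i + 1 ≤ m + j))
      have h1 := hpr.dist_add_dist_le_of_meets_nbhd hX hδ hK hμ0 (hqc j hj) hS
        (h.geodesic_meets_nbhd_fibre hm hn (by omega) (by omega) hxs.1 hxj hzs.1 hzs.2.1 hS)
      linarith [le_max_left r (H + K)]
  · intro i j hij hj x hx
    have hxs := hslab i (by omega) x hx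
    have hwj := hfib (m + j) (by omega) (by omega)
    have h1 := h.sub_le_dist hX hK hm hn hmn (a := x) (b := w j)
      ⟨hxs.1, le_trans (by push_cast; linarith [Nat.cast_nonneg (α := ℝ) i]) hxs.2.1,
        hxs.2.2.trans (by exact_mod_cast (by omega : m + i + 1 ≤ m + N))⟩
      (by
        rw [hwi j hj]
        refine ⟨hwj.1, ?_, ?_⟩ <;> rw [hwj.2] <;> exact_mod_cast (by omega))
    have h2 := hxs.2.2
    rw [hwi j hj, hwj.2] at h1
    rw [hwi j hj]
    push_cast at h1 h2
    linarith
  · have := DottedPath.Joins.concatFrom (α := α') (m := m) (w := w) (Nat.succ_pos N)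
      fun i hi => hjoin i (by omega)
    rwa [hwN, hwi 0 (by omega), Nat.cast_zero, add_zero] at this
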